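/- Let $n\ge 1$ and let $K\subset\mathbb R^n$ be a convex body (a compact convex set with nonempty interior). Let $C(K)$ be the space of continuous functions $f:K\to\mathbb R$ with $\|f\|_{C(K)}=\max_{x\in K}|f(x)|$, and let $\Pi_1(\mathbb R^n)$ be the space of real polynomials in $n$ variables of degree at most $1$. Let $x^{(1)},\dots,x^{(n+1)}\in K$ be the vertices of a nondegenerate simplex $S\subset K$, and let $P:C(K)\to\Pi_1(\mathbb R^n)$ be the interpolation projector with these nodes, i.e. the linear operator with $Pf(x^{(j)})=f(x^{(j)})$ for $1\le j\le n+1$ and all $f\in C(K)$. Let $\|P\|_K=\sup\{\|(Pf)|_K\|_{C(K)}:\|f\|_{C(K)}\le 1\}$, and let $\mathbf A$ be the $(n+1)\times(n+1)$ node matrix whose $j$th row is $(x^{(j)}_1,\dots,x^{(j)}_n,1)$. Let $$\chi_n(t)=\frac{1}{2^n n!}\,\frac{d^n}{dt^n}\,(t^2-1)^n$$ be the standardized Legendre polynomial of degree $n$, and let $\chi_n^{-1}$ be the inverse of the bijection $\chi_n:[1,\infty)\to[1,\infty)$. Then $\|P\|_K$ is finite, the numbers $\dfrac{n!\,\mathrm{vol}(K)}{|\det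 \mathbf A|}$ and $\dfrac{\mathrm{vol}(K)}{\mathrm{vol}(S)}$ are at least $1$, and $$\|P\|_K\;\ge\;\chi_n^{-1}\!\left(\frac{n!\,\mathrm{vol}(K)}{|\det \mathbf A|}\right)=\chi_n^{-1}\!\left(\frac{\mathrm{vol}(K)}{\mathrm{vol}(S)}\right).$$ -/

import Mathlib

open MeasureTheory

namespace LinInterp

section Legendre

open Polynomial

/-- The standardized Legendre polynomial `χ_n`, by Rodrigues' formula
`χ_n(t) = (1 / (2 ^ n n!)) [(t ^ 2 - 1) ^ n] ^ (n)`. -/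
noncomputable def legendre (n : ℕ) : ℝ[X] :=
  C (1 / (2 ^ n * (n.factorial : ℝ))) * derivative^[n] ((X ^ 2 - 1) ^ n)

/-- `χ_n⁻¹`, the inverse of `χ_n` on the half-line `[1, ∞)`. It is a genuine two-sided inverse
between `[1, ∞)` and `[1, ∞)` for `n ≥ 1`, see `legendre_bijOn`. -/
noncomputable def legendreInv (n : ℕ) : ℝ → ℝ :=
  Function.invFunOn (fun t : ℝ => (legendre n).eval t) (Set.Ici 1)

theorem legendre_comp_coeff (n k : ℕ) :
    ((legendre n).comp (X + 1)).coeff k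
      = 1 / (2 ^ n * (n.factorial : ℝ)) *
        (((k + n).descFactorial n : ℝ) * (((X : ℝ[X]) + 2) ^ n).coeff k) := by
  have h1 : (derivative^[n] (((X : ℝ[X]) ^ 2 - 1) ^ n)).comp (X + 1)
      = derivative^[n] ((((X : ℝ[X]) ^ 2 - 1) ^ n).comp (X + 1)) := by
    generalize ((X : ℝ[X]) ^ 2 - 1) ^ n = p
    induction n generalizing p with
    | zero => simp
    | succ m ih =>
      rw [Function.iterate_succ_apply, Function.iterate_succ_apply, ih, derivative_comp]
      simp
  have h2 : (((X : ℝ[X]) ^ 2 - 1) ^ n).comp (X + 1) = (X + 2) ^ n * X ^ n := by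
    simp only [pow_comp, sub_comp, X_comp, one_comp]
    rw [← mul_pow]
    congr 1
    ring
  rw [legendre, mul_comp, C_comp, coeff_C_mul, h1, h2, coeff_iterate_derivative, coeff_mul_X_pow]
  simp

theorem coeff_X_add_two_pow (n k : ℕ) :
    (((X : ℝ[X]) + 2) ^ n).coeff k = 2 ^ (n - k) * (n.choose k : ℝ) := by
  rw [← coeff_X_add_C_pow (2 : ℝ) n k, map_ofNat]

theorem legendre_comp_coeff_nonneg (n k : ℕ) : 0 ≤ ((legendre n).comp (X + 1)).coeff k := by
  rw [legendre_comp_coeff]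
  have h : (((X : ℝ[X]) + 2) ^ n).coeff k = 2 ^ (n - k) * (n.choose k : ℝ) := by
    simp [coeff_X_add_two_pow]
  rw [h]
  positivity

theorem legendre_eval_eq (n : ℕ) (t : ℝ) :
    (legendre n).eval t = ((legendre n).comp (X + 1)).eval (t - 1) := by
  simp

theorem legendre_eval_one (n : ℕ) : (legendre n).eval 1 = 1 := by
  rw [legendre_eval_eq, sub_self, ← coeff_zero_eq_eval_zero, legendre_comp_coeff]
  have h : (((X : ℝ[X]) + 2) ^ n).coeff 0 = 2 ^ n := by
    simp [coeff_X_add_two_pow]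
  rw [h, zero_add, Nat.descFactorial_self]
  field_simp

theorem legendre_lower (n : ℕ) {s t : ℝ} (hs : 1 ≤ s) (hst : s ≤ t) :
    (legendre n).eval s + (t - s) * ((legendre n).comp (X + 1)).coeff 1
      ≤ (legendre n).eval t := by
  rw [legendre_eval_eq n s, legendre_eval_eq n t]
  set q := (legendre n).comp (X + 1) with hq
  have hc : ∀ k, 0 ≤ q.coeff k := legendre_comp_coeff_nonneg n
  have hN : 1 ∈ Finset.range (q.natDegree + 2) := by simp
  rw [eval_eq_sum_range' (lt_add_of_pos_right q.natDegree (by norm_num : 0 < 2)),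
    eval_eq_sum_range' (lt_add_of_pos_right q.natDegree (by norm_num : 0 < 2))]
  rw [← Finset.add_sum_erase _ _ hN, ← Finset.add_sum_erase _ _ hN]
  have hle : ∑ x ∈ (Finset.range (q.natDegree + 2)).erase 1, q.coeff x * (s - 1) ^ x
      ≤ ∑ x ∈ (Finset.range (q.natDegree + 2)).erase 1, q.coeff x * (t - 1) ^ x := by
    apply Finset.sum_le_sum
    intro k _
    apply mul_le_mul_of_nonneg_left _ (hc k)
    apply pow_le_pow_left₀ <;> linarith
  simp only [pow_one]
  nlinarith

theorem legendre_slope_pos {n : ℕ} (hn : 1 ≤ n) :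
    0 < ((legendre n).comp (X + 1)).coeff 1 := by
  rw [legendre_comp_coeff]
  have h : (((X : ℝ[X]) + 2) ^ n).coeff 1 = 2 ^ (n - 1) * (n : ℝ) := by
    simp [coeff_X_add_two_pow]
  have h2 : 0 < (1 + n).descFactorial n := Nat.descFactorial_pos.2 (by omega)
  rw [h]
  have : (0 : ℝ) < n := by exact_mod_cast hn
  positivity

theorem legendre_strictMonoOn {n : ℕ} (hn : 1 ≤ n) :
    StrictMonoOn (fun t : ℝ => (legendre n).eval t) (Set.Ici 1) := by
  intro s hs t _ hst
  have h1 := legendre_lower n hs hst.le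
  have h2 := mul_pos (sub_pos.2 hst) (legendre_slope_pos hn)
  simp only
  linarith

/-- For `n ≥ 1`, `χ_n` is a bijection of `[1, ∞)` onto itself. -/
theorem legendre_bijOn {n : ℕ} (hn : 1 ≤ n) :
    Set.BijOn (fun t : ℝ => (legendre n).eval t) (Set.Ici 1) (Set.Ici 1) := by
  refine ⟨?_, (legendre_strictMonoOn hn).injOn, ?_⟩
  · intro t ht
    have := (legendre_strictMonoOn hn).monotoneOn (Set.mem_Ici.2 le_rfl) ht ht
    simpa [legendre_eval_one] using this
  · intro s hs
    have hs : 1 ≤ s := hs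
    set c := ((legendre n).comp (X + 1)).coeff 1
    have hc : 0 < c := legendre_slope_pos hn
    have hT : 1 ≤ 1 + (s - 1) / c := by
      have : 0 ≤ (s - 1) / c := div_nonneg (by linarith) hc.le
      linarith
    have h := legendre_lower n le_rfl hT
    rw [legendre_eval_one, add_sub_cancel_left, div_mul_cancel₀ _ hc.ne'] at h
    obtain ⟨t, ht, hts⟩ := intermediate_value_Icc hT
      ((legendre n).continuous.continuousOn (s := Set.Icc 1 (1 + (s - 1) / c)))
      (show s ∈ Set.Icc _ _ from ⟨by rw [legendre_eval_one]; exact hs, by linarith⟩)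
    exact ⟨t, ht.1, hts⟩

end Legendre

/-- The space `Π₁(ℝⁿ)` of polynomials in `n` variables of degree at most `1`. -/
noncomputable abbrev Pi1 (n : ℕ) : Submodule ℝ (MvPolynomial (Fin n) ℝ) :=
  MvPolynomial.restrictTotalDegree (Fin n) ℝ 1

/-- The restriction to `K` of the function `ℝⁿ → ℝ` defined by a polynomial. -/
noncomputable def restrictTo {n : ℕ} (K : Set (EuclideanSpace ℝ (Fin n)))
    (p : MvPolynomial (Fin n) ℝ) : C(K, ℝ) where
  toFun y := MvPolynomial.eval (fun i => (y : EuclideanSpace ℝ (Fin n)) i) p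
  continuous_toFun := (MvPolynomial.continuous_eval p).comp (by fun_prop)

/-- The linear operator `P : C(K) → Π₁(ℝⁿ)` is the interpolation projector whose nodes are the
vertices of the nondegenerate simplex `S`: the vertices lie in `K`, and `P f` agrees with `f`
at each of them. -/
def IsInterpolationProjector {n : ℕ} (K : Set (EuclideanSpace ℝ (Fin n)))
    (S : Affine.Simplex ℝ (EuclideanSpace ℝ (Fin n)) n) (P : C(K, ℝ) →ₗ[ℝ] Pi1 n) : Prop :=
  ∀ j : Fin (n + 1), ∃ hj : S.points j ∈ K, ∀ f : C(K, ℝ),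
    MvPolynomial.eval (fun i => S.points j i) (P f : MvPolynomial (Fin n) ℝ) = f ⟨S.points j, hj⟩

/-- The set of all `‖(P f)|_K‖_{C(K)}` with `‖f‖_{C(K)} ≤ 1`. -/
def unitBallNorms {n : ℕ} (K : Set (EuclideanSpace ℝ (Fin n))) [CompactSpace K]
    (P : C(K, ℝ) →ₗ[ℝ] Pi1 n) : Set ℝ :=
  {r | ∃ f : C(K, ℝ), ‖f‖ ≤ 1 ∧ r = ‖restrictTo K (P f : MvPolynomial (Fin n) ℝ)‖}

/-- `‖P‖_K`, the norm of `P` as an operator from `C(K)` into `C(K)`. -/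
noncomputable def projNorm {n : ℕ} (K : Set (EuclideanSpace ℝ (Fin n))) [CompactSpace K]
    (P : C(K, ℝ) →ₗ[ℝ] Pi1 n) : ℝ :=
  sSup (unitBallNorms K P)

/-- The node matrix: its `j`-th row consists of the coordinates of the `j`-th vertex,
followed by `1`. -/
def nodeMatrix {n : ℕ} (S : Affine.Simplex ℝ (EuclideanSpace ℝ (Fin n)) n) :
    Matrix (Fin (n + 1)) (Fin (n + 1)) ℝ :=
  Matrix.of fun j => Fin.snoc (α := fun _ => ℝ) (fun i : Fin n => S.points j i) 1

/-- The volume of the simplex `S`, the convex hull of its vertices. -/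
noncomputable def simplexVol {n : ℕ} (S : Affine.Simplex ℝ (EuclideanSpace ℝ (Fin n)) n) : ℝ :=
  volume.real (convexHull ℝ (Set.range S.points))

end LinInterp

namespace LinInterp

/-! Let `λ_j` be the barycentric coordinates of `S`. They are the Lagrange basis of `P`, so `Σ
|λ_j(x)| ≤ γ := ‖P‖_K` for every `x ∈ K` (`sum_abs_coord_le_projNorm`). Since `Σ λ_j = 1`, the
negative parts of the `λ_j` sum to at most `(γ - 1) / 2` and the positive parts to at most `(γ + 1)
/ 2`. Dropping `λ_0` places `K` inside an affine image of `signedSimplex n ((γ - 1) / 2) ((γ + 1) /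
2)`, whose volume is `χ_n(γ) / n!` (`volume_signedSimplex`, `signedVol_eq_legendre`). The chart
scales volume by `|det A| = n! vol(S)`, hence `vol(K) ≤ χ_n(γ) vol(S)`; monotonicity of `χ_n` on
`[1, ∞)` concludes. -/

/-! ### Volume of the signed simplex -/

/-- The points whose negative parts sum up to at most `a` and whose positive parts sum up to at
most `b`. -/
def signedSimplex (n : ℕ) (a b : ℝ) : Set (Fin n → ℝ) :=
  {x | ∑ i, max (-x i) 0 ≤ a ∧ ∑ i, max (x i) 0 ≤ b}

/-- The volume of `signedSimplex n a b` for nonnegative `a` and `b`. -/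
noncomputable def signedVol (n : ℕ) (a b : ℝ) : ℝ :=
  ∑ ij ∈ Finset.HasAntidiagonal.antidiagonal n,
    (n.choose ij.1 : ℝ) * (a ^ ij.1 / (ij.1.factorial : ℝ) * (b ^ ij.2 / (ij.2.factorial : ℝ)))

theorem isClosed_signedSimplex (n : ℕ) (a b : ℝ) : IsClosed (signedSimplex n a b) :=
  have h1 : Continuous fun x : Fin n → ℝ => ∑ i, max (-x i) 0 := by fun_prop
  have h2 : Continuous fun x : Fin n → ℝ => ∑ i, max (x i) 0 := by fun_prop
  (isClosed_le h1 continuous_const).inter (isClosed_le h2 continuous_const)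

theorem signedSimplex_eq_empty {n : ℕ} {a b : ℝ} (h : a < 0 ∨ b < 0) :
    signedSimplex n a b = ∅ := by
  ext x
  simp only [signedSimplex, Set.mem_ofPred_eq, Set.mem_empty_iff_false, iff_false]
  have h1 : 0 ≤ ∑ i, max (-x i) 0 := Finset.sum_nonneg fun i _ => le_max_right _ _
  have h2 : 0 ≤ ∑ i, max (x i) 0 := Finset.sum_nonneg fun i _ => le_max_right _ _
  rintro ⟨h3, h4⟩
  rcases h with h | h <;> linarith

theorem signedVol_nonneg (n : ℕ) {a b : ℝ} (ha : 0 ≤ a) (hb : 0 ≤ b) : 0 ≤ signedVol n a b :=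
  Finset.sum_nonneg fun _ _ => by positivity

theorem continuous_signedVol (n : ℕ) : Continuous fun p : ℝ × ℝ => signedVol n p.1 p.2 := by
  unfold signedVol
  fun_prop

theorem integral_pow_div_factorial (j : ℕ) (b : ℝ) :
    ∫ t in (0 : ℝ)..b, t ^ j / (j.factorial : ℝ) = b ^ (j + 1) / ((j + 1).factorial : ℝ) := by
  rw [intervalIntegral.integral_div, integral_pow, Nat.factorial_succ]
  have : (j.factorial : ℝ) ≠ 0 := by positivity
  push_cast
  field_simp
  simp

/-- Pascal's rule, with each factor `x ^ (k + 1) / (k + 1)!` written as an integral. The two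
integrals correspond to a new coordinate that is positive or negative. -/
theorem signedVol_succ (n : ℕ) (a b : ℝ) :
    signedVol (n + 1) a b
      = (∫ t in (0 : ℝ)..b, signedVol n a t) + ∫ t in (0 : ℝ)..a, signedVol n t b := by
  unfold signedVol
  rw [intervalIntegral.integral_finsetSum fun i _ =>
      Continuous.intervalIntegrable (by fun_prop) _ _,
    intervalIntegral.integral_finsetSum fun i _ =>
      Continuous.intervalIntegrable (by fun_prop) _ _,
    Finset.sum_antidiagonal_choose_succ_mul
      fun i j => a ^ i / (i.factorial : ℝ) * (b ^ j / (j.factorial : ℝ))]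
  congr 1
  · refine Finset.sum_congr rfl fun ij _ => ?_
    rw [intervalIntegral.integral_const_mul, intervalIntegral.integral_const_mul,
      integral_pow_div_factorial]
  · refine Finset.sum_congr rfl fun ij hij => ?_
    rw [intervalIntegral.integral_const_mul, intervalIntegral.integral_mul_const,
      integral_pow_div_factorial, Nat.choose_symm_of_eq_add (Finset.HasAntidiagonal.mem_antidiagonal.1 hij).symm]

theorem lintegral_Icc_eq_intervalIntegral {f : ℝ → ℝ} (hf : Continuous f) {a b : ℝ} (hab : a ≤ b)
    (h0 : ∀ t ∈ Set.Icc a b, 0 ≤ f t) :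
    ∫⁻ t in Set.Icc a b, ENNReal.ofReal (f t) = ENNReal.ofReal (∫ t in a..b, f t) := by
  rw [intervalIntegral.integral_of_le hab, ← integral_Icc_eq_integral_Ioc,
    ofReal_integral_eq_lintegral_ofReal hf.continuousOn.integrableOn_Icc]
  exact (ae_restrict_iff' measurableSet_Icc).2 (Filter.Eventually.of_forall h0)

/-- Induction by slicing along the first coordinate `t`: a positive `t` uses up part of `b`, a
negative one part of `a`, and the slice is again a signed simplex. -/
theorem volume_signedSimplex (n : ℕ) {a b : ℝ} (ha : 0 ≤ a) (hb : 0 ≤ b) :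
    volume (signedSimplex n a b) = ENNReal.ofReal (signedVol n a b) := by
  induction n generalizing a b with
  | zero =>
    have : signedSimplex 0 a b = Set.univ := by
      ext x; simp [signedSimplex, ha, hb]
    simp [this, signedVol, volume_pi]
  | succ n ih =>
    have hmp := (volume_preserving_piFinSuccAbove (fun _ : Fin (n + 1) => ℝ) 0).symm
    have hm := (isClosed_signedSimplex (n + 1) a b).measurableSet
    rw [← hmp.measure_preimage hm.nullMeasurableSet, Measure.volume_eq_prod,
      Measure.prod_apply (hmp.measurable hm)]
    -- The half-open `Ico (-a) 0` keeps `t = 0` from being counted twice.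
    have hslice : ∀ t : ℝ, volume (Prod.mk t ⁻¹'
        ((MeasurableEquiv.piFinSuccAbove (fun _ : Fin (n + 1) => ℝ) 0).symm ⁻¹'
          signedSimplex (n + 1) a b))
        = (Set.Icc 0 b).indicator (fun t => ENNReal.ofReal (signedVol n a (b - t))) t
          + (Set.Ico (-a) 0).indicator (fun t => ENNReal.ofReal (signedVol n (a + t) b)) t := by
      intro t
      have hmem : Prod.mk t ⁻¹'
        ((MeasurableEquiv.piFinSuccAbove (fun _ : Fin (n + 1) => ℝ) 0).symm ⁻¹'
          signedSimplex (n + 1) a b) = signedSimplex n (a - max (-t) 0) (b - max t 0) := by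
        ext y
        simp [signedSimplex, MeasurableEquiv.piFinSuccAbove, Fin.sum_univ_succ,
          le_sub_iff_add_le']
      rw [hmem]
      rcases le_or_gt 0 t with ht | ht
      · rw [max_eq_right (by linarith), max_eq_left ht, sub_zero,
          Set.indicator_of_notMem (s := Set.Ico (-a) 0) (fun h => absurd h.2 (not_lt.2 ht)),
          add_zero]
        by_cases htb : t ≤ b
        · rw [Set.indicator_of_mem (show t ∈ Set.Icc 0 b from ⟨ht, htb⟩), ih ha (by linarith)]
        · rw [Set.indicator_of_notMem (fun h => htb h.2),
            signedSimplex_eq_empty (Or.inr (by linarith)), measure_empty]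
      · rw [max_eq_left (by linarith), max_eq_right ht.le, sub_zero, sub_neg_eq_add,
          Set.indicator_of_notMem (s := Set.Icc 0 b) (fun h => absurd h.1 (not_le.2 ht)),
          zero_add]
        by_cases hta : -a ≤ t
        · rw [Set.indicator_of_mem (show t ∈ Set.Ico (-a) 0 from ⟨hta, ht⟩), ih (by linarith) hb]
        · rw [Set.indicator_of_notMem (fun h => hta h.1),
            signedSimplex_eq_empty (Or.inl (by linarith)), measure_empty]
    have hc1 : Continuous fun t => signedVol n a (b - t) :=
      (continuous_signedVol n).comp (by fun_prop : Continuous fun t : ℝ => (a, b - t))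
    have hc2 : Continuous fun t => signedVol n (a + t) b :=
      (continuous_signedVol n).comp (by fun_prop : Continuous fun t : ℝ => (a + t, b))
    have hi1 : ∫ t in (0 : ℝ)..b, signedVol n a (b - t) = ∫ t in (0 : ℝ)..b, signedVol n a t := by
      simp
    have hi2 : ∫ t in (-a)..0, signedVol n (a + t) b = ∫ t in (0 : ℝ)..a, signedVol n t b := by
      simp [intervalIntegral.integral_comp_add_left fun t => signedVol n t b]
    rw [lintegral_congr hslice,
      lintegral_add_left ((hc1.measurable.ennreal_ofReal).indicator measurableSet_Icc),
      lintegral_indicator measurableSet_Icc, lintegral_indicator measurableSet_Ico,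
      setLIntegral_congr Ico_ae_eq_Icc,
      lintegral_Icc_eq_intervalIntegral hc1 hb
        fun t ht => signedVol_nonneg n ha (by linarith [ht.2]),
      lintegral_Icc_eq_intervalIntegral hc2 (by linarith)
        fun t ht => signedVol_nonneg n (by linarith [ht.1]) hb,
      hi1, hi2, signedVol_succ, ENNReal.ofReal_add]
    · exact intervalIntegral.integral_nonneg hb fun t ht => signedVol_nonneg n ha ht.1
    · exact intervalIntegral.integral_nonneg ha fun t ht => signedVol_nonneg n ht.1 hb

/-! ### Signed volumes and Legendre polynomials -/

theorem signedVol_zero_one (n : ℕ) : signedVol n 0 1 = 1 / (n.factorial : ℝ) := by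
  unfold signedVol
  rw [Finset.sum_eq_single (0, n)]
  · simp
  · rintro ⟨i, j⟩ hij hne
    have : i ≠ 0 := by
      rintro rfl
      exact hne (by simpa using hij)
    simp [this]
  · simp

/-- Leibniz's rule applied to `(t + 1) ^ n * (t - 1) ^ n` in Rodrigues' formula. -/
theorem signedVol_eq_legendre (n : ℕ) (t : ℝ) :
    signedVol n ((t - 1) / 2) ((t + 1) / 2) = (legendre n).eval t / (n.factorial : ℝ) := by
  have hf : ((Polynomial.X : Polynomial ℝ) ^ 2 - 1) ^ n
      = (Polynomial.X + Polynomial.C 1) ^ n * (Polynomial.X - Polynomial.C 1) ^ n := by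
    rw [← mul_pow]
    congr 1
    simp only [map_one]
    ring
  -- The swap matches the Leibniz index `k` with the exponent of `(t + 1) / 2`.
  rw [legendre, hf, Polynomial.iterate_derivative_mul, Polynomial.eval_mul, Polynomial.eval_C,
    Polynomial.eval_finsetSum, signedVol, ← Finset.Nat.sum_antidiagonal_swap,
    Finset.Nat.sum_antidiagonal_eq_sum_range_succ_mk, Finset.mul_sum, Finset.sum_div]
  refine Finset.sum_congr rfl fun k hk => ?_
  have hk : k ≤ n := Nat.lt_succ_iff.1 (Finset.mem_range.1 hk)
  rw [Polynomial.iterate_derivative_X_add_pow, Polynomial.iterate_derivative_X_sub_pow]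
  simp only [Prod.swap, nsmul_eq_mul, Polynomial.eval_mul, Polynomial.eval_natCast,
    Polynomial.eval_pow, Polynomial.eval_add, Polynomial.eval_sub, Polynomial.eval_X,
    Polynomial.eval_C, Nat.sub_sub_self hk, Nat.choose_symm hk]
  have h1 : (n.descFactorial k : ℝ) * ((n - k).factorial : ℝ) = (n.factorial : ℝ) := by
    rw [mul_comm]; exact_mod_cast Nat.factorial_mul_descFactorial hk
  have h2 : (n.descFactorial (n - k) : ℝ) * (k.factorial : ℝ) = (n.factorial : ℝ) := by
    have := Nat.factorial_mul_descFactorial (Nat.sub_le n k)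
    rw [Nat.sub_sub_self hk] at this
    rw [mul_comm]; exact_mod_cast this
  have e1 : (n.descFactorial k : ℝ) = n.factorial / (n - k).factorial := by
    rw [eq_div_iff (by positivity), h1]
  have e2 : (n.descFactorial (n - k) : ℝ) = n.factorial / k.factorial := by
    rw [eq_div_iff (by positivity), h2]
  have e3 : (2 : ℝ) ^ n = 2 ^ (n - k) * 2 ^ k := by rw [← pow_add, Nat.sub_add_cancel hk]
  rw [e1, e2, e3, div_pow, div_pow]
  field_simp


/-! ### The affine chart of the simplex -/

/-- The matrix whose columns are the edge vectors of `S` issuing from its vertex `0`. -/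
def edgeMatrix {n : ℕ} (S : Affine.Simplex ℝ (EuclideanSpace ℝ (Fin n)) n) :
    Matrix (Fin n) (Fin n) ℝ :=
  Matrix.of fun i j => S.points j.succ i - S.points 0 i

/-- Subtracting row `0` from the others leaves a single nonzero entry in the last column; expansion
along it gives the edge determinant up to sign. -/
theorem abs_det_nodeMatrix {n : ℕ} (S : Affine.Simplex ℝ (EuclideanSpace ℝ (Fin n)) n) :
    |(nodeMatrix S).det| = |(edgeMatrix S).det| := by
  set B : Matrix (Fin (n + 1)) (Fin (n + 1)) ℝ := Matrix.of fun i j =>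
    nodeMatrix S i j - (if i = 0 then 0 else 1) * nodeMatrix S 0 j with hB
  have h1 : (nodeMatrix S).det = B.det := by
    refine Matrix.det_eq_of_forall_row_eq_smul_add_const (fun i => if i = 0 then 0 else 1) 0
      (by simp) fun i j => ?_
    simp [hB]
  have h2 : B.submatrix (Fin.succAbove 0) (Fin.succAbove (Fin.last n))
      = (edgeMatrix S).transpose := by
    ext i j
    simp [hB, nodeMatrix, edgeMatrix]
  rw [h1, Matrix.det_succ_column B (Fin.last n), Finset.sum_eq_single 0, h2,
    Matrix.det_transpose]
  · simp [hB, nodeMatrix, abs_mul]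
  · intro i _ hi
    simp [hB, nodeMatrix, hi]
  · simp

/-- The affine chart of `ℝⁿ` taking the standard simplex to the simplex `S`. -/
noncomputable def simplexChart {n : ℕ} (S : Affine.Simplex ℝ (EuclideanSpace ℝ (Fin n)) n)
    (u : Fin n → ℝ) : EuclideanSpace ℝ (Fin n) :=
  WithLp.toLp 2 ((edgeMatrix S).toLin' u + WithLp.ofLp (S.points 0))

theorem simplexChart_tail {n : ℕ} (S : Affine.Simplex ℝ (EuclideanSpace ℝ (Fin n)) n)
    {w : Fin (n + 1) → ℝ} (hw : ∑ j, w j = 1) :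
    simplexChart S (Fin.tail w) = ∑ j, w j • S.points j := by
  ext i
  rw [Fin.sum_univ_succ] at hw
  have h0 : w 0 = 1 - ∑ j : Fin n, w j.succ := by linarith
  simp only [simplexChart, edgeMatrix, Matrix.toLin'_apply, Matrix.mulVec, dotProduct,
    Matrix.of_apply, Fin.tail, Pi.add_apply, Fin.sum_univ_succ, WithLp.ofLp_sum, WithLp.ofLp_smul,
    WithLp.ofLp_add, Pi.smul_apply, Finset.sum_apply, smul_eq_mul, h0]
  simp only [sub_mul, Finset.sum_mul, one_mul, Finset.sum_sub_distrib]
  simp only [mul_comm]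
  ring

theorem volume_simplexChart_image {n : ℕ} (S : Affine.Simplex ℝ (EuclideanSpace ℝ (Fin n)) n)
    (s : Set (Fin n → ℝ)) :
    volume (simplexChart S '' s) = ENNReal.ofReal |(nodeMatrix S).det| * volume s := by
  have h : simplexChart S '' s = (MeasurableEquiv.toLp 2 (Fin n → ℝ)).symm ⁻¹'
      ((fun v => v + WithLp.ofLp (S.points 0)) '' ((edgeMatrix S).toLin' '' s)) := by
    rw [MeasurableEquiv.preimage_symm, Set.image_image, Set.image_image]
    rfl
  rw [h, (EuclideanSpace.volume_preserving_symm_measurableEquiv_toLp (Fin n)).measure_preimage_equiv,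
    Set.image_add_right, measure_preimage_add_right, Measure.addHaar_image_linearMap,
    LinearMap.det_toLin', abs_det_nodeMatrix]

/-- Negative and positive parts have difference `1` and total `Σ |w j|`, which yields `(γ ∓ 1) / 2`;
discarding `w 0` only lowers both sums. -/
theorem tail_mem_signedSimplex {n : ℕ} {w : Fin (n + 1) → ℝ} (hw : ∑ j, w j = 1) {γ : ℝ}
    (hγ : ∑ j, |w j| ≤ γ) : Fin.tail w ∈ signedSimplex n ((γ - 1) / 2) ((γ + 1) / 2) := by
  have hneg : ∑ j, max (-w j) 0 = (∑ j, |w j| - ∑ j, w j) / 2 := by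
    rw [← Finset.sum_sub_distrib, Finset.sum_div]
    refine Finset.sum_congr rfl fun j _ => ?_
    rcases le_total 0 (w j) with h | h
    · rw [abs_of_nonneg h, max_eq_right (by linarith)]; ring
    · rw [abs_of_nonpos h, max_eq_left (by linarith)]; ring
  have hpos : ∑ j, max (w j) 0 = (∑ j, |w j| + ∑ j, w j) / 2 := by
    rw [← Finset.sum_add_distrib, Finset.sum_div]
    refine Finset.sum_congr rfl fun j _ => ?_
    rcases le_total 0 (w j) with h | h
    · rw [abs_of_nonneg h, max_eq_left h]; ring
    · rw [abs_of_nonpos h, max_eq_right h]; ring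
  rw [Fin.sum_univ_succ] at hneg hpos
  have h1 := le_max_right (-w 0) 0
  have h2 := le_max_right (w 0) 0
  constructor <;> simp only [Fin.tail] <;> linarith

/-- The vertices of a full-dimensional simplex as an affine basis. -/
noncomputable def simplexBasis {n : ℕ} (S : Affine.Simplex ℝ (EuclideanSpace ℝ (Fin n)) n) :
    AffineBasis (Fin (n + 1)) ℝ (EuclideanSpace ℝ (Fin n)) :=
  ⟨S.points, S.independent, S.span_eq_top (by simp)⟩

theorem sum_coord_smul_points {n : ℕ} (S : Affine.Simplex ℝ (EuclideanSpace ℝ (Fin n)) n)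
    (x : EuclideanSpace ℝ (Fin n)) : ∑ j, (simplexBasis S).coord j x • S.points j = x :=
  (simplexBasis S).linear_combination_coord_eq_self x

theorem mem_simplexChart_image {n : ℕ} (S : Affine.Simplex ℝ (EuclideanSpace ℝ (Fin n)) n)
    {x : EuclideanSpace ℝ (Fin n)} {γ : ℝ} (hγ : ∑ j, |(simplexBasis S).coord j x| ≤ γ) :
    x ∈ simplexChart S '' signedSimplex n ((γ - 1) / 2) ((γ + 1) / 2) :=
  ⟨_, tail_mem_signedSimplex ((simplexBasis S).sum_coord_apply_eq_one x) hγ, by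
    rw [simplexChart_tail S ((simplexBasis S).sum_coord_apply_eq_one x), sum_coord_smul_points]⟩

/-- The case `γ = 1` of the same family, so the volume formula for `signedSimplex` also computes
`vol(S)`. -/
theorem simplexChart_image_eq {n : ℕ} (S : Affine.Simplex ℝ (EuclideanSpace ℝ (Fin n)) n) :
    simplexChart S '' signedSimplex n 0 1 = convexHull ℝ (Set.range S.points) := by
  apply Set.Subset.antisymm
  · rintro _ ⟨u, ⟨hu0, hu1⟩, rfl⟩
    have hnn : ∀ i, 0 ≤ u i := fun i => by
      have h1 := Finset.single_le_sum (f := fun i => max (-u i) 0)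
        (fun i _ => le_max_right _ _) (Finset.mem_univ i)
      have h2 := le_max_left (-u i) 0
      linarith
    have hsum : ∑ i, u i ≤ 1 := (Finset.sum_le_sum fun i _ => le_max_left _ _).trans hu1
    have hw : ∑ j, (Fin.cons (1 - ∑ i, u i) u : Fin (n + 1) → ℝ) j = 1 := by
      simp [Fin.sum_univ_succ]
    have h := simplexChart_tail S hw
    rw [Fin.tail_cons] at h
    rw [h]
    refine (convex_convexHull ℝ _).sum_mem (fun j _ => ?_) hw
      fun j _ => subset_convexHull ℝ _ ⟨j, rfl⟩
    refine Fin.cases ?_ (fun i => ?_) j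
    · simpa using hsum
    · simpa using hnn i
  · intro x hx
    have hx : ∀ j, 0 ≤ (simplexBasis S).coord j x := by
      have := (simplexBasis S).convexHull_eq_nonneg_coord
      change convexHull ℝ (Set.range S.points) = _ at this
      rw [this] at hx
      exact hx
    have h1 : ∑ j, |(simplexBasis S).coord j x| ≤ 1 := by
      rw [← (simplexBasis S).sum_coord_apply_eq_one x]
      exact Finset.sum_le_sum fun j _ => (abs_of_nonneg (hx j)).le
    have := mem_simplexChart_image S h1
    norm_num at this
    exact this

theorem simplexVol_eq {n : ℕ} (S : Affine.Simplex ℝ (EuclideanSpace ℝ (Fin n)) n) :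
    simplexVol S = |(nodeMatrix S).det| / (n.factorial : ℝ) := by
  rw [simplexVol, Measure.real, ← simplexChart_image_eq, volume_simplexChart_image,
    volume_signedSimplex n le_rfl zero_le_one, signedVol_zero_one, ENNReal.toReal_mul,
    ENNReal.toReal_ofReal (abs_nonneg _), ENNReal.toReal_ofReal (by positivity)]
  ring

theorem simplexVol_pos {n : ℕ} (S : Affine.Simplex ℝ (EuclideanSpace ℝ (Fin n)) n) :
    0 < simplexVol S := by
  have hne : (interior (convexHull ℝ (Set.range S.points))).Nonempty :=
    interior_convexHull_nonempty_iff_affineSpan_eq_top.2 (S.span_eq_top (by simp))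
  have hc : IsCompact (convexHull ℝ (Set.range S.points)) :=
    Set.Finite.isCompact_convexHull ℝ (Set.finite_range S.points)
  exact ENNReal.toReal_pos (Measure.measure_pos_of_nonempty_interior _ hne).ne' hc.measure_lt_top.ne

theorem volume_le_legendre {n : ℕ} (S : Affine.Simplex ℝ (EuclideanSpace ℝ (Fin n)) n)
    {K : Set (EuclideanSpace ℝ (Fin n))} {γ : ℝ} (hγ1 : 1 ≤ γ)
    (hγ : ∀ x ∈ K, ∑ j, |(simplexBasis S).coord j x| ≤ γ) :
    volume.real K ≤ (legendre n).eval γ * simplexVol S := by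
  have hv := volume_simplexChart_image S (signedSimplex n ((γ - 1) / 2) ((γ + 1) / 2))
  have hn := signedVol_nonneg n (a := (γ - 1) / 2) (b := (γ + 1) / 2) (by linarith) (by linarith)
  rw [volume_signedSimplex n (by linarith) (by linarith),
    ← ENNReal.ofReal_mul (abs_nonneg _)] at hv
  have h := measure_mono (μ := volume) fun x hx => mem_simplexChart_image S (hγ x hx)
  rw [hv] at h
  refine (ENNReal.toReal_le_of_le_ofReal (mul_nonneg (abs_nonneg _) hn) h).trans_eq ?_
  rw [simplexVol_eq, signedVol_eq_legendre]
  ring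

/-! ### The projector in barycentric coordinates -/

/-- Each monomial is constant or a single variable; the constant one needs `∑ j, w j = 1`. -/
theorem eval_sum_smul_of_mem_Pi1 {n : ℕ} {p : MvPolynomial (Fin n) ℝ} (hp : p ∈ Pi1 n)
    {ι : Type*} [Fintype ι] (w : ι → ℝ) (hw : ∑ j, w j = 1)
    (x : ι → EuclideanSpace ℝ (Fin n)) :
    MvPolynomial.eval (fun i => (∑ j, w j • x j) i) p
      = ∑ j, w j * MvPolynomial.eval (fun i => x j i) p := by
  rw [MvPolynomial.mem_restrictTotalDegree] at hp
  simp only [MvPolynomial.eval_eq, Finset.mul_sum]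
  rw [Finset.sum_comm]
  refine Finset.sum_congr rfl fun d hd => ?_
  have hd1 : d.sum (fun _ e => e) ≤ 1 := (MvPolynomial.le_totalDegree hd).trans hp
  have hd2 : d = 0 ∨ ∃ i, d = Finsupp.single i 1 := by
    by_cases h0 : d = 0
    · exact Or.inl h0
    · obtain ⟨i, hi⟩ := Finsupp.ne_iff.1 h0
      refine Or.inr ⟨i, ?_⟩
      have hle : Finsupp.single i 1 ≤ d := by
        rw [Finsupp.single_le_iff]
        exact Nat.one_le_iff_ne_zero.2 (by simpa using hi)
      obtain ⟨e, rfl⟩ := exists_add_of_le hle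
      have he : e.degree = 0 := by
        have h1 : (Finsupp.single i 1 + e).degree ≤ 1 := hd1
        rw [map_add, Finsupp.degree_single] at h1
        omega
      rw [(Finsupp.degree_eq_zero_iff e).1 he, add_zero]
  rcases hd2 with rfl | ⟨i, rfl⟩
  · simp [← Finset.sum_mul, hw]
  · simp [Finset.mul_sum, Finsupp.support_single, mul_left_comm]

theorem eval_projector {n : ℕ} {K : Set (EuclideanSpace ℝ (Fin n))}
    {S : Affine.Simplex ℝ (EuclideanSpace ℝ (Fin n)) n} {P : C(K, ℝ) →ₗ[ℝ] Pi1 n}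
    (hP : IsInterpolationProjector K S P) (f : C(K, ℝ)) (x : EuclideanSpace ℝ (Fin n)) :
    MvPolynomial.eval (fun i => x i) (P f : MvPolynomial (Fin n) ℝ)
      = ∑ j, (simplexBasis S).coord j x * f ⟨S.points j, (hP j).1⟩ := by
  conv_lhs => rw [← sum_coord_smul_points S x]
  rw [eval_sum_smul_of_mem_Pi1 (P f).2 _ ((simplexBasis S).sum_coord_apply_eq_one x)]
  exact Finset.sum_congr rfl fun j _ => by rw [(hP j).2 f]

theorem continuous_coord {n : ℕ} (S : Affine.Simplex ℝ (EuclideanSpace ℝ (Fin n)) n)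
    (j : Fin (n + 1)) : Continuous ((simplexBasis S).coord j) :=
  AffineMap.continuous_of_finiteDimensional _

theorem bddAbove_unitBallNorms {n : ℕ} {K : Set (EuclideanSpace ℝ (Fin n))} [CompactSpace K]
    {S : Affine.Simplex ℝ (EuclideanSpace ℝ (Fin n)) n} {P : C(K, ℝ) →ₗ[ℝ] Pi1 n}
    (hP : IsInterpolationProjector K S P) : BddAbove (unitBallNorms K P) := by
  let g : C(K, ℝ) := ⟨fun x => ∑ j, |(simplexBasis S).coord j x|,
    continuous_finsetSum _ fun j _ => ((continuous_coord S j).comp continuous_subtype_val).abs⟩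
  refine ⟨‖g‖, ?_⟩
  rintro r ⟨f, hf, rfl⟩
  refine (ContinuousMap.norm_le _ (norm_nonneg _)).2 fun x => ?_
  change ‖MvPolynomial.eval _ _‖ ≤ _
  rw [eval_projector hP]
  refine le_trans ?_ ((le_abs_self _).trans (g.norm_coe_le_norm x))
  refine (norm_sum_le _ _).trans (Finset.sum_le_sum fun j _ => ?_)
  rw [norm_mul]
  exact mul_le_of_le_one_right (norm_nonneg _) ((f.norm_coe_le_norm _).trans hf)

/-- The extremal `f` takes the value `sign λ_j(x)` at the `j`-th vertex, so `P f` at `x` equals `Σ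
|λ_j(x)|`. -/
theorem sum_abs_coord_le_projNorm {n : ℕ} {K : Set (EuclideanSpace ℝ (Fin n))} [CompactSpace K]
    {S : Affine.Simplex ℝ (EuclideanSpace ℝ (Fin n)) n} {P : C(K, ℝ) →ₗ[ℝ] Pi1 n}
    (hP : IsInterpolationProjector K S P) {x : EuclideanSpace ℝ (Fin n)} (hx : x ∈ K) :
    ∑ j, |(simplexBasis S).coord j x| ≤ projNorm K P := by
  let s : Fin (n + 1) → ℝ := fun j => SignType.sign ((simplexBasis S).coord j x)
  have hs : ∀ j, -1 ≤ s j ∧ s j ≤ 1 := fun j => by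
    cases h : SignType.sign ((simplexBasis S).coord j x) <;> simp [s, h]
  -- Clamping the affine interpolant of the signs gives norm at most `1` without changing its vertex
  -- values, which already lie in `[-1, 1]`.
  let f : C(K, ℝ) := ⟨fun y => max (-1) (min 1 (∑ j, s j * (simplexBasis S).coord j y)),
    continuous_const.max (continuous_const.min (continuous_finsetSum _ fun j _ =>
      continuous_const.mul ((continuous_coord S j).comp continuous_subtype_val)))⟩
  have hf : ‖f‖ ≤ 1 := (ContinuousMap.norm_le _ zero_le_one).2 fun y =>
    abs_le.2 ⟨le_max_left _ _, max_le (by norm_num) (min_le_left _ _)⟩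
  have hfj : ∀ j, f ⟨S.points j, (hP j).1⟩ = s j := fun j => by
    have h : ∑ i, s i * (simplexBasis S).coord i (S.points j) = s j := by
      have hc : ∀ i, (simplexBasis S).coord i (S.points j) = if i = j then 1 else 0 :=
        fun i => (simplexBasis S).coord_apply i j
      simp [hc]
    change max (-1) (min 1 (∑ i, s i * (simplexBasis S).coord i (S.points j))) = s j
    rw [h, min_eq_right (hs j).2, max_eq_right (hs j).1]
  have h1 : restrictTo K (P f : MvPolynomial (Fin n) ℝ) ⟨x, hx⟩
      = ∑ j, |(simplexBasis S).coord j x| := by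
    refine (eval_projector hP f x).trans (Finset.sum_congr rfl fun j _ => ?_)
    rw [hfj]
    exact self_mul_sign _
  rw [← h1]
  exact ((le_abs_self _).trans ((restrictTo K (P f : MvPolynomial (Fin n) ℝ)).norm_coe_le_norm ⟨x, hx⟩)).trans
    (le_csSup (bddAbove_unitBallNorms hP) ⟨f, hf, rfl⟩)

/-- Places `γ` in `[1, ∞)`, where `χ_n` is monotone and `(γ - 1) / 2 ≥ 0`. -/
theorem one_le_projNorm {n : ℕ} {K : Set (EuclideanSpace ℝ (Fin n))} [CompactSpace K]
    {S : Affine.Simplex ℝ (EuclideanSpace ℝ (Fin n)) n} {P : C(K, ℝ) →ₗ[ℝ] Pi1 n}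
    (hP : IsInterpolationProjector K S P) : 1 ≤ projNorm K P := by
  refine le_trans ?_ (sum_abs_coord_le_projNorm hP (hP 0).1)
  rw [← (simplexBasis S).sum_coord_apply_eq_one (S.points 0)]
  exact Finset.sum_le_sum fun j _ => le_abs_self _

/-! ### Inversion of `χ_n` and conclusion -/

theorem legendreInv_le {n : ℕ} (hn : 1 ≤ n) {s γ : ℝ} (hs : 1 ≤ s) (hγ : 1 ≤ γ)
    (h : s ≤ (legendre n).eval γ) : legendreInv n s ≤ γ := by
  have hex : ∃ t ∈ Set.Ici (1 : ℝ), (legendre n).eval t = s := (legendre_bijOn hn).surjOn hs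
  have hmem : legendreInv n s ∈ Set.Ici (1 : ℝ) := Function.invFunOn_mem hex
  have heq : (legendre n).eval (legendreInv n s) = s := Function.invFunOn_eq hex
  exact ((legendre_strictMonoOn hn).le_iff_le hmem hγ).1 (heq.le.trans h)

end LinInterp

theorem mainTheorem3 (n : ℕ) (hn : 1 ≤ n) (K : Set (EuclideanSpace ℝ (Fin n)))
    (hKconv : Convex ℝ K) [CompactSpace K] (hKint : (interior K).Nonempty)
    (S : Affine.Simplex ℝ (EuclideanSpace ℝ (Fin n)) n)
    (P : C(K, ℝ) →ₗ[ℝ] LinInterp.Pi1 n) (hP : LinInterp.IsInterpolationProjector K S P) :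
    -- the supremum that defines `‖P‖_K` is finite
    BddAbove (LinInterp.unitBallNorms K P) ∧
    -- both arguments of `χ_n⁻¹` lie in its domain
    1 ≤ (n.factorial : ℝ) * volume.real K / |(LinInterp.nodeMatrix S).det| ∧
    1 ≤ volume.real K / LinInterp.simplexVol S ∧
    -- the inequality and the equality
    LinInterp.legendreInv n
        ((n.factorial : ℝ) * volume.real K / |(LinInterp.nodeMatrix S).det|)
      ≤ LinInterp.projNorm K P ∧
    LinInterp.legendreInv n
        ((n.factorial : ℝ) * volume.real K / |(LinInterp.nodeMatrix S).det|)
      = LinInterp.legendreInv n (volume.real K / LinInterp.simplexVol S) := by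
  have hpos := LinInterp.simplexVol_pos S
  have heq : (n.factorial : ℝ) * volume.real K / |(LinInterp.nodeMatrix S).det|
      = volume.real K / LinInterp.simplexVol S := by
    rw [LinInterp.simplexVol_eq, div_div_eq_mul_div, mul_comm]
  have hK : IsCompact K := isCompact_iff_compactSpace.2 inferInstance
  -- Convexity of `K` gives `S ⊆ K`, hence a volume ratio of at least `1`, within the domain of
  -- `χ_n⁻¹`.
  have hSK : convexHull ℝ (Set.range S.points) ⊆ K := convexHull_min
    (Set.range_subset_iff.2 fun j => (hP j).1) hKconv
  have h1 : 1 ≤ volume.real K / LinInterp.simplexVol S :=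
    (one_le_div hpos).2 (measureReal_mono hSK hK.measure_lt_top.ne)
  have h2 := LinInterp.one_le_projNorm hP
  rw [heq]
  exact ⟨LinInterp.bddAbove_unitBallNorms hP, h1, h1, LinInterp.legendreInv_le hn h1 h2
    ((div_le_iff₀ hpos).2 (LinInterp.volume_le_legendre S h2
      fun x hx => LinInterp.sum_abs_coord_le_projNorm hP hx)), rfl⟩
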